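/- Let $N\ge 2$ and $\mathcal M=\{1,\dots,N\}$. Let $(\Omega,\mathcal F,\mathsf P)$ be a complete probability space carrying a standard Brownian motion $W$ and, for each $i\in\mathcal M$, a right-continuous Markov chain $Y^i$ on $\mathcal M$ with $Y^i_0=i$ a.s., independent of $W$, with an irreducible generator $Q=(q_{jk})$ ($q_{jk}\ge 0$ for $j\neq k$, $q_{jj}=-\sum_{k\ne j}q_{jk}<0$). Let $\mathbb F^i$ be the filtration jointly generated by $W$ and $Y^i$, augmented by the $\mathsf P$-null sets. Let $\lambda_1\ge\dots\ge\lambda_N$, $\sigma\in\mathbb R$ and $\rho,c_1,c_2>0$ be constants. Let $h:\mathbb R\to[0,\infty)$ vanish on $(-\infty,0]$, be strictly convex, increasing and $C^1$ on $[0,\infty)$, with $h'(0)=0$, $\lim_{x\to\infty}h'(x)=\infty$ and $\sup_{x\ge0}(px-h(x))<\infty$ for all $p>0$, and suppose that for some $m>1$ and $K_1,K_2,K_3>0$, for all $x,y\in\mathbb R$, $$h(x)\le K_1(1+|x|^m),\quad |h'(x)|\le K_2(1+|x|^{m-1}),\quad |h'(x)-h'(y)|\le K_3|x-y|\,(1+|x|^{(m-2)^+}).$$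 (The case study is $N=2$ and $h(x)=\tfrac12 (x^+)^2$, with $m=2$.) The base interest rate $r$ and the GDP growth rate $g$ enter only through $\mu=r-g$. Let $D$ be the set of all $\mu\in\mathbb R$ with $$\frac{c_1}{c_2}>\frac{\rho-\mu-\lambda_N}{\rho-\mu-\lambda_1}\quad\text{and}\quad \rho>\Big((\mu+\lambda_1)\vee\big(m(\mu+\lambda_1)+\tfrac{\sigma^2}{2}m(m-1)\big)\Big)^+ .$$ For $i\in\mathcal M$ and $\mu\in\mathbb R$ put $X_t=X^{i;\mu}_t=\exp\big((\mu-\tfrac12\sigma^2)t+\int_0^t\lambda_{Y^i_s}\,ds+\sigma W_t\big)$ and, for $x\ge 0$ and $[0,\infty]$-valued $\mathbb F^i$-stopping times $\tau,\theta$, $$\Psi_{x,i;\mu}(\tau,\theta)=\mathsf E\Big[\int_0^{\tau\wedge\theta}e^{-\rho t}X_t\,h'(xX_t)\,dt+c_2e^{-\rho\tau}X_\tau\mathbf 1_{\{\tau<\theta\}}+c_1e^{-\rho\theta}X_\theta\mathbf 1_{\{\theta<\tau\}}+\kappa e^{-\rho\tau}X_\tau\mathbf 1_{\{\tau=\theta\}}\Big],$$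 where $e^{-\rho\zeta}X_\zeta:=0$ on $\{\zeta=\infty\}$ and $\kappa\in[0,c_1]$ is an arbitrary fixed constant (the payoff when both players stop simultaneously). Let $v(x,i;\mu)$ denote the value of this Dynkin game; the statement holds both for the lower value $v(x,i;\mu)=\sup_\tau\inf_\theta\Psi_{x,i;\mu}(\tau,\theta)$ and for the upper value $v(x,i;\mu)=\inf_\theta\sup_\tau\Psi_{x,i;\mu}(\tau,\theta)$. Define the free boundaries $$a(i;\mu)=\inf\{x\ge0: v(x,i;\mu)>c_2\},\qquad b(i;\mu)=\sup\{x\ge0: v(x,i;\mu)<c_1\}$$ in $[0,\infty]$, with $\inf\emptyset=\infty$ and $\sup\emptyset=0$. Then, for every $i\in\mathcal M$, the maps $\mu\mapsto a(i;\mu)$ and $\mu\mapsto b(i;\mu)$ are decreasing (in the weak sense, i.e. nonincreasing) on $D$. -/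

import Mathlib

open MeasureTheory ProbabilityTheory Set Filter
open scoped NNReal ENNReal Topology

noncomputable section

namespace DebtGame

/-- Irreducible generator matrix of a continuous-time Markov chain on `{1, …, N}`
(indexed by `Fin N`). -/
structure IsIrreducibleGenerator {N : ℕ} (Q : Matrix (Fin N) (Fin N) ℝ) : Prop where
  nonneg_off_diag : ∀ i j, i ≠ j → 0 ≤ Q i j
  row_sum_zero : ∀ i, ∑ j, Q i j = 0
  diag_neg : ∀ i, Q i i < 0
  irreducible : ∀ i j, Relation.ReflTransGen (fun k l => k ≠ l ∧ 0 < Q k l) i j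

/-- `Y` is a right-continuous Markov chain with generator `Q` started from `i`:
`P(Y_{s+t} = j | Y_u, u ≤ s) = (exp (t Q))_{Y_s, j}`. -/
structure IsMarkovChainFrom {Ω : Type*} [MeasurableSpace Ω] {N : ℕ}
    (Q : Matrix (Fin N) (Fin N) ℝ) (i : Fin N) (Y : ℝ≥0 → Ω → Fin N) (P : Measure Ω) : Prop where
  measurable : ∀ t, Measurable (Y t)
  start : ∀ᵐ ω ∂P, Y 0 ω = i
  right_continuous : ∀ᵐ ω ∂P, ∀ t, ContinuousWithinAt (fun s => Y s ω) (Ici t) t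
  markov : ∀ (s t : ℝ≥0) (j : Fin N),
    P[{ω | Y (s + t) ω = j}.indicator (fun _ => (1 : ℝ)) |
        ⨆ u ∈ Iic s, MeasurableSpace.comap (Y u) inferInstance]
      =ᵐ[P] fun ω => NormedSpace.exp ((t : ℝ) • Q) (Y s ω) j

/-- The filtration jointly generated by `W` and `Y`, augmented by the `P`-null sets. -/
def jointFiltration {Ω : Type*} [mΩ : MeasurableSpace Ω] {N : ℕ} {W : ℝ≥0 → Ω → ℝ}
    {Y : ℝ≥0 → Ω → Fin N} (P : Measure Ω) [P.IsComplete]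
    (hW : ∀ t, Measurable (W t)) (hY : ∀ t, Measurable (Y t)) : Filtration ℝ≥0 mΩ where
  seq t := (⨆ s ∈ Iic t, MeasurableSpace.comap (W s) inferInstance) ⊔
    (⨆ s ∈ Iic t, MeasurableSpace.comap (Y s) inferInstance) ⊔
    MeasurableSpace.generateFrom {A | P A = 0}
  mono' s t hst := by
    have hsub : Iic s ⊆ Iic t := Iic_subset_Iic.2 hst
    exact sup_le_sup_right (sup_le_sup (biSup_mono hsub) (biSup_mono hsub)) _
  le' t := by
    refine sup_le (sup_le (iSup₂_le fun s _ => (hW s).comap_le)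
      (iSup₂_le fun s _ => (hY s).comap_le)) (MeasurableSpace.generateFrom_le fun A hA => ?_)
    exact Measure.IsComplete.out' A hA

/-- Running cost functions with growth exponent `m`. Since `h = 0` on `(-∞, 0]` and `h'(0) = 0`,
being `C¹` on `[0, ∞)` is the same as being `C¹` on `ℝ`, and `deriv h` is the derivative `h'`. -/
structure IsRunningCost (h : ℝ → ℝ) (m : ℝ) : Prop where
  nonneg : ∀ x, 0 ≤ h x
  strictConvex : StrictConvexOn ℝ (Ici 0) h
  contDiff : ContDiff ℝ 1 h
  strictMono : StrictMonoOn h (Ici 0)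
  eq_zero : ∀ x ≤ 0, h x = 0
  deriv_zero : deriv h 0 = 0
  deriv_tendsto : Tendsto (deriv h) atTop atTop
  one_lt : 1 < m
  growth : ∃ K > 0, ∀ x, h x ≤ K * (1 + |x| ^ m)
  deriv_growth : ∃ K > 0, ∀ x, |deriv h x| ≤ K * (1 + |x| ^ (m - 1))
  deriv_lipschitz : ∃ K > 0, ∀ x y,
    |deriv h x - deriv h y| ≤ K * |x - y| * (1 + |x| ^ (max (m - 2) 0))
  legendre : ∀ p > 0, BddAbove ((fun x => p * x - h x) '' Ici 0)

/-- The standing conditions on the parameters, as conditions on `μ = r - g`; here `lamMax` and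
`lamMin` are the largest and the smallest additional interest rates. -/
structure IsAdmissible (ρ σ m c₁ c₂ lamMax lamMin μ : ℝ) : Prop where
  cost_ratio : (ρ - μ - lamMin) / (ρ - μ - lamMax) < c₁ / c₂
  discount : max (max (μ + lamMax) (m * (μ + lamMax) + σ ^ 2 / 2 * m * (m - 1))) 0 < ρ

/-- The values of `μ = r - g` that satisfy the standing conditions. -/
def admissibleSet (ρ σ m c₁ c₂ lamMax lamMin : ℝ) : Set ℝ :=
  {μ | IsAdmissible ρ σ m c₁ c₂ lamMax lamMin μ}

/-- The uncontrolled debt ratio `X^{1,i,0}` started from level `1`, when the regime process is `Y`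
and `r - g = μ`. -/
def debtRatio {Ω : Type*} {N : ℕ} (σ : ℝ) (lam : Fin N → ℝ) (W : ℝ≥0 → Ω → ℝ)
    (Y : ℝ≥0 → Ω → Fin N) (μ : ℝ) (t : ℝ≥0) (ω : Ω) : ℝ :=
  Real.exp ((μ - σ ^ 2 / 2) * t + (∫ s in (0 : ℝ)..t, lam (Y s.toNNReal ω)) + σ * W t ω)

/-- The random variable `e^{-ρ τ} X_τ`, with value `0` on `{τ = ∞}`. -/
def discountedAt {Ω : Type*} (ρ : ℝ) (X : ℝ≥0 → Ω → ℝ) (τ : Ω → WithTop ℝ≥0) (ω : Ω) : ℝ≥0∞ :=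
  WithTop.recTopCoe 0 (fun t : ℝ≥0 => ENNReal.ofReal (Real.exp (-ρ * t) * X t ω)) (τ ω)

/-- Expected payoff `Ψ_x(τ, θ)` of the game, where `X` is the uncontrolled debt ratio started
from `1`. All terms are nonnegative, so the expectation is taken in `[0, ∞]`.
On `{τ = θ}` the terminal payoff is `κ e^{-ρ τ} X_τ`. -/
def payoff {Ω : Type*} [MeasurableSpace Ω] (P : Measure Ω) (ρ c₁ c₂ κ : ℝ) (h : ℝ → ℝ)
    (X : ℝ≥0 → Ω → ℝ) (x : ℝ≥0) (τ θ : Ω → WithTop ℝ≥0) : ℝ≥0∞ :=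
  ∫⁻ ω, ((∫⁻ t in {t : ℝ | 0 ≤ t ∧ (t.toNNReal : WithTop ℝ≥0) < min (τ ω) (θ ω)},
        ENNReal.ofReal (Real.exp (-ρ * t) * X t.toNNReal ω * deriv h (x * X t.toNNReal ω)))
      + {ω | τ ω < θ ω}.indicator (fun ω => ENNReal.ofReal c₂ * discountedAt ρ X τ ω) ω
      + {ω | θ ω < τ ω}.indicator (fun ω => ENNReal.ofReal c₁ * discountedAt ρ X θ ω) ω
      + {ω | τ ω = θ ω}.indicator (fun ω => ENNReal.ofReal κ * discountedAt ρ X τ ω) ω) ∂P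

/-- `sup_τ inf_θ Ψ(τ, θ)` over stopping times of `𝔽`. -/
def lowerValue {Ω : Type*} {mΩ : MeasurableSpace Ω} (𝔽 : Filtration ℝ≥0 mΩ)
    (Ψ : (Ω → WithTop ℝ≥0) → (Ω → WithTop ℝ≥0) → ℝ≥0∞) : ℝ≥0∞ :=
  ⨆ (τ : Ω → WithTop ℝ≥0) (_ : IsStoppingTime 𝔽 τ),
    ⨅ (θ : Ω → WithTop ℝ≥0) (_ : IsStoppingTime 𝔽 θ), Ψ τ θ

/-- `inf_θ sup_τ Ψ(τ, θ)` over stopping times of `𝔽`. -/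
def upperValue {Ω : Type*} {mΩ : MeasurableSpace Ω} (𝔽 : Filtration ℝ≥0 mΩ)
    (Ψ : (Ω → WithTop ℝ≥0) → (Ω → WithTop ℝ≥0) → ℝ≥0∞) : ℝ≥0∞ :=
  ⨅ (θ : Ω → WithTop ℝ≥0) (_ : IsStoppingTime 𝔽 θ),
    ⨆ (τ : Ω → WithTop ℝ≥0) (_ : IsStoppingTime 𝔽 τ), Ψ τ θ

/-- `a = inf {x ≥ 0 : v(x) > c₂}`, with `inf ∅ = ∞`. -/
def boundaryA (c₂ : ℝ) (v : ℝ≥0 → ℝ≥0∞) : ℝ≥0∞ :=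
  ⨅ (x : ℝ≥0) (_ : ENNReal.ofReal c₂ < v x), (x : ℝ≥0∞)

/-- `b = sup {x ≥ 0 : v(x) < c₁}`, with `sup ∅ = 0`. -/
def boundaryB (c₁ : ℝ) (v : ℝ≥0 → ℝ≥0∞) : ℝ≥0∞ :=
  ⨆ (x : ℝ≥0) (_ : v x < ENNReal.ofReal c₁), (x : ℝ≥0∞)

end DebtGame

end

namespace DebtGame

open MeasureTheory Set
open scoped NNReal ENNReal

/-! Raising `μ` from `μ₁` to `μ₂` multiplies `X_t` by `e^{(μ₂ - μ₁) t} ≥ 1`, while the filtration,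
and hence both players' stopping times, does not depend on `μ`. Convexity and `h'(0) = 0` make `h'`
nonnegative and nondecreasing on `[0, ∞)`, so for each fixed pair `(τ, θ)` every term of the payoff
grows with the path of `X` (`payoff_mono`). Suprema and infima preserve this order, so both values
are nondecreasing in `μ`; neither a saddle point nor equality of the two values is needed. The
boundaries reverse the order of `v` (`boundaryA_anti`, `boundaryB_anti`). -/

theorem IsRunningCost.monotoneOn_deriv {h : ℝ → ℝ} {m : ℝ} (hh : IsRunningCost h m) :
    MonotoneOn (deriv h) (Ici 0) :=
  hh.strictConvex.convexOn.monotoneOn_deriv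
    fun x _ => (hh.contDiff.differentiable one_ne_zero).differentiableAt

theorem IsRunningCost.deriv_nonneg {h : ℝ → ℝ} {m : ℝ} (hh : IsRunningCost h m) {x : ℝ}
    (hx : 0 ≤ x) : 0 ≤ deriv h x :=
  hh.deriv_zero ▸ hh.monotoneOn_deriv self_mem_Ici hx hx

theorem debtRatio_nonneg {Ω : Type*} {N : ℕ} (σ : ℝ) (lam : Fin N → ℝ) (W : ℝ≥0 → Ω → ℝ)
    (Y : ℝ≥0 → Ω → Fin N) (μ : ℝ) (t : ℝ≥0) (ω : Ω) : 0 ≤ debtRatio σ lam W Y μ t ω :=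
  (Real.exp_pos _).le

/-- The debt ratio is pathwise nondecreasing in `μ`. -/
theorem debtRatio_mono {Ω : Type*} {N : ℕ} (σ : ℝ) (lam : Fin N → ℝ) (W : ℝ≥0 → Ω → ℝ)
    (Y : ℝ≥0 → Ω → Fin N) : Monotone (debtRatio σ lam W Y) := by
  intro μ₁ μ₂ hμ t ω
  unfold debtRatio
  gcongr

theorem discountedAt_mono {Ω : Type*} (ρ : ℝ) : Monotone (discountedAt (Ω := Ω) ρ) := by
  intro X₁ X₂ hX τ ω
  unfold discountedAt
  induction τ ω using WithTop.recTopCoe with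
  | top => exact le_rfl
  | coe t =>
    exact ENNReal.ofReal_le_ofReal (mul_le_mul_of_nonneg_left (hX t ω) (Real.exp_pos _).le)

/-- The expected payoff is nondecreasing in the path of the debt ratio. -/
theorem payoff_mono {Ω : Type*} [MeasurableSpace Ω] (P : Measure Ω) (ρ c₁ c₂ κ : ℝ) {h : ℝ → ℝ}
    {m : ℝ} (hh : IsRunningCost h m) {X₁ X₂ : ℝ≥0 → Ω → ℝ} (h₀ : ∀ t ω, 0 ≤ X₁ t ω)
    (hX : X₁ ≤ X₂) (x : ℝ≥0) (τ θ : Ω → WithTop ℝ≥0) :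
    payoff P ρ c₁ c₂ κ h X₁ x τ θ ≤ payoff P ρ c₁ c₂ κ h X₂ x τ θ := by
  -- Both factors are nonnegative and nondecreasing in the path: `x ≥ 0` keeps the argument of `h'`
  -- in `[0, ∞)`.
  have run (t : ℝ) (ω : Ω) :
      Real.exp (-ρ * t) * X₁ t.toNNReal ω * deriv h (x * X₁ t.toNNReal ω) ≤
        Real.exp (-ρ * t) * X₂ t.toNNReal ω * deriv h (x * X₂ t.toNNReal ω) := by
    have h₁ := h₀ t.toNNReal ω
    have h₁₂ := hX t.toNNReal ω
    have hx₁ : 0 ≤ (x : ℝ) * X₁ t.toNNReal ω := mul_nonneg x.2 h₁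
    have hx₂ : (x : ℝ) * X₁ t.toNNReal ω ≤ x * X₂ t.toNNReal ω :=
      mul_le_mul_of_nonneg_left h₁₂ x.2
    exact mul_le_mul (mul_le_mul_of_nonneg_left h₁₂ (Real.exp_pos _).le)
      (hh.monotoneOn_deriv hx₁ (hx₁.trans hx₂) hx₂) (hh.deriv_nonneg hx₁)
      (mul_nonneg (Real.exp_pos _).le (h₁.trans h₁₂))
  -- The time domain and the three events depend on `τ` and `θ` only, so the terms can be compared
  -- one by one.
  refine lintegral_mono fun ω => add_le_add (add_le_add (add_le_add ?_ ?_) ?_) ?_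
  · exact lintegral_mono fun t => ENNReal.ofReal_le_ofReal (run t ω)
  all_goals
    exact indicator_le_indicator (mul_le_mul_right (discountedAt_mono ρ hX _ ω) _)

theorem lowerValue_mono {Ω : Type*} {mΩ : MeasurableSpace Ω} (𝔽 : Filtration ℝ≥0 mΩ) :
    Monotone (lowerValue 𝔽) :=
  fun _ _ hΨ => iSup₂_mono fun τ _ => iInf₂_mono fun θ _ => hΨ τ θ

theorem upperValue_mono {Ω : Type*} {mΩ : MeasurableSpace Ω} (𝔽 : Filtration ℝ≥0 mΩ) :
    Monotone (upperValue 𝔽) :=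
  fun _ _ hΨ => iInf₂_mono fun θ _ => iSup₂_mono fun τ _ => hΨ τ θ

/-- A larger `v` enlarges `{v > c₂}`, which lowers its infimum; dually, `{v < c₁}` shrinks and its
supremum drops. The conventions for `∅` fit this order, and no monotonicity of `v` in `x` is needed.
-/
theorem boundaryA_anti (c₂ : ℝ) : Antitone (boundaryA c₂) :=
  fun _ _ hv => le_iInf₂ fun x hx => iInf₂_le x (hx.trans_le (hv x))

theorem boundaryB_anti (c₁ : ℝ) : Antitone (boundaryB c₁) :=
  fun _ _ hv => iSup₂_le fun x hx => le_iSup₂_of_le x ((hv x).trans_lt hx) le_rfl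

end DebtGame

open DebtGame in
theorem proposition6p1 {Ω : Type*} [MeasurableSpace Ω] (P : Measure Ω) [IsProbabilityMeasure P]
    [P.IsComplete] {N : ℕ} (hN : 2 ≤ N) (Q : Matrix (Fin N) (Fin N) ℝ)
    (hQ : IsIrreducibleGenerator Q)
    (W : ℝ≥0 → Ω → ℝ) (hW : IsBrownianReal W P) (hWm : ∀ t, Measurable (W t))
    (Y : Fin N → ℝ≥0 → Ω → Fin N) (hY : ∀ i, IsMarkovChainFrom Q i (Y i) P)
    (hWY : ∀ i, IndepFun (fun ω t => W t ω) (fun ω t => Y i t ω) P)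
    (lam : Fin N → ℝ) (hlam : Antitone lam)
    (σ ρ m c₁ c₂ κ : ℝ) (hρ : 0 < ρ) (hc₁ : 0 < c₁) (hc₂ : 0 < c₂) (hκ : κ ∈ Icc 0 c₁)
    (h : ℝ → ℝ) (hh : IsRunningCost h m)
    (D : Set ℝ)
    (hD : D = admissibleSet ρ σ m c₁ c₂ (lam ⟨0, by omega⟩) (lam ⟨N - 1, by omega⟩))
    (vLow vUp : Fin N → ℝ → ℝ≥0 → ℝ≥0∞)
    (hvLow : ∀ i μ x, vLow i μ x = lowerValue (jointFiltration P hWm (hY i).measurable)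
      (payoff P ρ c₁ c₂ κ h (debtRatio σ lam W (Y i) μ) x))
    (hvUp : ∀ i μ x, vUp i μ x = upperValue (jointFiltration P hWm (hY i).measurable)
      (payoff P ρ c₁ c₂ κ h (debtRatio σ lam W (Y i) μ) x)) :
    ∀ i : Fin N,
      AntitoneOn (fun μ => boundaryA c₂ (vLow i μ)) D ∧
      AntitoneOn (fun μ => boundaryB c₁ (vLow i μ)) D ∧
      AntitoneOn (fun μ => boundaryA c₂ (vUp i μ)) D ∧
      AntitoneOn (fun μ => boundaryB c₁ (vUp i μ)) D := by
  intro i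
  have hΨ {μ₁ μ₂ : ℝ} (hμ : μ₁ ≤ μ₂) (x : ℝ≥0) :
      payoff P ρ c₁ c₂ κ h (debtRatio σ lam W (Y i) μ₁) x ≤
        payoff P ρ c₁ c₂ κ h (debtRatio σ lam W (Y i) μ₂) x := fun τ θ =>
    payoff_mono P ρ c₁ c₂ κ hh (debtRatio_nonneg σ lam W (Y i) μ₁)
      (debtRatio_mono σ lam W (Y i) hμ) x τ θ
  have hLow : Monotone (vLow i) := fun μ₁ μ₂ hμ x => by
    rw [hvLow, hvLow]
    exact lowerValue_mono _ (hΨ hμ x)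
  have hUp : Monotone (vUp i) := fun μ₁ μ₂ hμ x => by
    rw [hvUp, hvUp]
    exact upperValue_mono _ (hΨ hμ x)
  -- The monotonicity holds for all real `μ` and is then restricted to `D`.
  exact ⟨((boundaryA_anti c₂).comp_monotone hLow).antitoneOn D,
    ((boundaryB_anti c₁).comp_monotone hLow).antitoneOn D,
    ((boundaryA_anti c₂).comp_monotone hUp).antitoneOn D,
    ((boundaryB_anti c₁).comp_monotone hUp).antitoneOn D⟩
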